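/- Let $G=(V,E)$ be a finite connected graph without loops, $N=|V|$, embedded in the plane in such a way that every face, including the outer one, is bounded by a triangle (for instance, the triangulation of a planar graph by additional edges). Let $J_e\in\mathbb R$ for $e\in E$ (with $J_e=0$ on edges that were only added to triangulate, if one wishes). Let $S=(s_v)_{v\in V}$ be random spins in $\{-1,+1\}$ distributed according to the zero-field Ising model $$\mathbb P(S=X)=\frac1Z\exp\Big(\sum_{e=\{v,w\}\in E}J_e x_v x_w\Big),\qquad Z=\sum_{X\in\{-1,+1\}^{V}}\exp\Big(\sum_{e=\{v,w\}\in E}J_e x_v x_w\Big).$$ The expanded dual graph $G^*=(V^*,E^*)$ is obtained from the dual graph of $G$ (whose vertices are the faces of $G$, with one dual edge crossing each edge of $G$) by replacing every face $f$ by a triangle $K_3$, called a city, in such a way that each of its three vertices is incident to exactly one of the three dual edges at $f$. The edges of these triangles are the city edges $E^*_C$; the other edges are the intercity edges $E^*_I$, and $g:E^*_I\to E$ denotes the bijection that sends an intercity edge to the edge of $G$ which it crosses. Let $\mathrm{PM}(G^*)$ be the set of perfect matchings of $G^*$, viewed as sets of edges. For $X\in\{-1,+1\}^V$ let $I(X)=\{e^*\in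 E^*_I : g(e^*)=\{v,w\},\ x_v=x_w\}$, and let $M(X)$ be the unique perfect matching of $G^*$ with $M(X)\cap E^*_I=I(X)$. Put $c_{e^*}=\exp(2J_{g(e^*)})$ for $e^*\in E^*_I$ and $c_{e^*}=1$ for $e^*\in E^*_C$. Then for every $E'\in\mathrm{PM}(G^*)$ $$\mathbb P\big(M(S)=E'\big)=\frac1{Z^*}\prod_{e^*\in E'}c_{e^*},$$ where $$Z^*=\sum_{E'\in\mathrm{PM}(G^*)}\ \prod_{e^*\in E'}c_{e^*}=\frac12\,Z\,\exp\Big(\sum_{e\in E}J_e\Big).$$ -/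

import Mathlib

noncomputable section

namespace PlanarIsing

/-- A graph without loops, with vertex set `V` and edge set `E`: every edge `e` has two distinct end
vertices, forming `ends e`; parallel edges are allowed.  The graph is normal when `ends` is injective. -/
structure Multigraph (V E : Type*) where
  ends : E → Sym2 V
  loopless : ∀ e, ¬ (ends e).IsDiag

namespace Multigraph

variable {V E : Type*} (G : Multigraph V E)

/-- Connectedness (nonemptiness of the vertex set included), through the underlying simple
graph. -/
def Connected : Prop :=
  (SimpleGraph.fromRel fun u v => ∃ e, G.ends e = s(u, v)).Connected

/-- A dart (oriented edge): an edge together with the end vertex at which it starts. -/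
abbrev Dart : Type _ := {p : E × V // p.2 ∈ G.ends p.1}

variable {G}

/-- The edge underlying a dart. -/
def Dart.edge (d : G.Dart) : E := d.1.1

/-- The start vertex of a dart. -/
def Dart.tail (d : G.Dart) : V := d.1.2

/-- The same edge, oriented the other way. -/
def Dart.flip (d : G.Dart) : G.Dart :=
  ⟨(d.1.1, Sym2.Mem.other d.2), Sym2.other_mem d.2⟩

/-- The end vertex of a dart. -/
def Dart.head (d : G.Dart) : V := d.flip.tail

theorem Dart.edge_flip (d : G.Dart) : d.flip.edge = d.edge := rfl

theorem Dart.ends_edge (d : G.Dart) : G.ends d.edge = s(d.tail, d.head) :=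
  (Sym2.other_spec d.2).symm

theorem Dart.head_ne_tail (d : G.Dart) : d.head ≠ d.tail :=
  Sym2.other_ne (G.loopless _) d.2

theorem Dart.ext_edge_tail {d d' : G.Dart} (h : d.edge = d'.edge) (h' : d.tail = d'.tail) :
    d = d' :=
  Subtype.ext (Prod.ext h h')

theorem Dart.head_flip (d : G.Dart) : d.flip.head = d.tail := by
  have h1 := d.ends_edge
  have h2 := d.flip.ends_edge
  rw [d.edge_flip, h1] at h2
  change s(d.tail, d.head) = s(d.head, d.flip.head) at h2
  rw [Sym2.eq_iff] at h2
  rcases h2 with ⟨h, -⟩ | ⟨h, -⟩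
  · exact absurd h.symm d.head_ne_tail
  · exact h.symm

theorem Dart.flip_flip (d : G.Dart) : d.flip.flip = d :=
  Dart.ext_edge_tail rfl d.head_flip

theorem Dart.flip_ne (d : G.Dart) : d.flip ≠ d := fun h =>
  d.head_ne_tail (congrArg Dart.tail h)

variable (G) in
/-- Orientation reversal as a permutation of the darts. -/
def flipPerm : Equiv.Perm G.Dart := ⟨Dart.flip, Dart.flip, Dart.flip_flip, Dart.flip_flip⟩

end Multigraph

open Multigraph

/-- A combinatorial embedding (rotation system) of `G` in an oriented closed surface: a permutation
`next` of the darts that, around every vertex, runs cyclically through all darts starting there. -/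
structure Embedding {V E : Type*} (G : Multigraph V E) where
  next : Equiv.Perm G.Dart
  tail_next : ∀ d, (next d).tail = d.tail
  next_cyclic : ∀ d d' : G.Dart, d.tail = d'.tail → next.SameCycle d d'

namespace Embedding

variable {V E : Type*} {G : Multigraph V E} (R : Embedding G)

/-- Tracing the boundary of a face: traverse the dart `d`, then leave its head along the dart that
follows the reversed dart in the rotation at that vertex. -/
def facePerm : Equiv.Perm G.Dart := G.flipPerm.trans R.next

/-- The faces of the embedding: the orbits of darts under `facePerm`. -/
abbrev Face : Type _ := Quotient (Equiv.Perm.SameCycle.setoid R.facePerm)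

/-- The face whose boundary walk contains the dart `d`. -/
def face (d : G.Dart) : R.Face := Quotient.mk _ d

/-- The embedding is an embedding in the plane (equivalently, the sphere): the graph is connected
and Euler's formula `|V| - |E| + |F| = 2` holds. -/
def IsPlanar : Prop :=
  G.Connected ∧ (Nat.card V : ℤ) - Nat.card E + Nat.card R.Face = 2

/-- Every face (the outer one included) is bounded by a triangle, that is, by exactly three
darts. -/
def IsTriangulation : Prop := ∀ f : R.Face, Nat.card {d : G.Dart // R.face d = f} = 3

theorem facePerm_apply (d : G.Dart) : R.facePerm d = R.next d.flip := rfl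

theorem tail_facePerm (d : G.Dart) : (R.facePerm d).tail = d.head := R.tail_next _

theorem face_eq_iff {d d' : G.Dart} : R.face d = R.face d' ↔ R.facePerm.SameCycle d d' :=
  Quotient.eq (r := Equiv.Perm.SameCycle.setoid R.facePerm)

theorem face_facePerm (d : G.Dart) : R.face (R.facePerm d) = R.face d :=
  R.face_eq_iff.2 (Equiv.Perm.sameCycle_apply_left.2 (Equiv.Perm.SameCycle.refl _ _))

theorem facePerm_ne (d : G.Dart) : R.facePerm d ≠ d := fun h =>
  d.head_ne_tail (by rw [← R.tail_facePerm, h])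

/-- The expanded dual graph `G*`.  The city of a face `f` is the triangle on the three darts `d`
with `face d = f`: the vertex `d` is the corner of the city of `f` which is incident to the edge
that leaves the city by crossing the edge `d.edge` of `G`, towards the corner `d.flip` of the city
on the other side of `d.edge`. -/
def expandedDual : SimpleGraph G.Dart where
  Adj d d' := d' = d.flip ∨ (d ≠ d' ∧ R.face d = R.face d')
  symm := ⟨by
    rintro d d' (rfl | ⟨h, h'⟩)
    · exact Or.inl d.flip_flip.symm
    · exact Or.inr ⟨h.symm, h'.symm⟩⟩
  loopless := ⟨by
    rintro d (h | ⟨h, -⟩)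
    · exact d.flip_ne h.symm
    · exact h rfl⟩

end Embedding

namespace Multigraph

variable {V E : Type*} (G : Multigraph V E)

/-- The intercity edges of the expanded dual graph: the edges `{d, d.flip}`, one for every edge of
`G`. -/
def intercityEdges : Set (Sym2 G.Dart) := {e | ∃ d : G.Dart, e = s(d, d.flip)}

/-- The intercity edges which cross an edge of `G` whose end vertices have equal spins. -/
def agreeingEdges (X : V → ℤˣ) : Set (Sym2 G.Dart) :=
  {e | ∃ d : G.Dart, e = s(d, d.flip) ∧ X d.tail = X d.head}

open Classical in
/-- The weight of an edge of the expanded dual graph: `exp (2 * J e)` for the intercity edge which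
crosses the edge `e` of `G`, and `1` for a city edge. -/
def dualWeight (J : E → ℝ) : Sym2 G.Dart → ℝ :=
  Sym2.lift ⟨fun d d' => if d' = d.flip then Real.exp (2 * J d.edge) else 1, by
    intro d d'
    by_cases h : d' = d.flip
    · subst h
      simp [d.flip_flip, d.edge_flip]
    · have h' : d ≠ d'.flip := fun hd => h (by rw [hd, d'.flip_flip])
      simp [h, h']⟩

/-- The energy `∑ J_e x_v x_w` over all edges `e = {v, w}`, for a spin assignment `X`. -/
def energy [Fintype E] (J : E → ℝ) (X : V → ℤˣ) : ℝ :=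
  ∑ e, J e * ((G.ends e).map fun v => ((X v : ℤ) : ℝ)).mul

open Classical in
/-- The partition function of the zero-field Ising model. -/
def isingPartition [Fintype V] [Fintype E] (J : E → ℝ) : ℝ :=
  ∑ X : V → ℤˣ, Real.exp (G.energy J X)

end Multigraph

/-- The perfect matchings of a graph. -/
abbrev PM {W : Type*} (H : SimpleGraph W) : Type _ := {P : H.Subgraph // P.IsPerfectMatching}

section PMModel

variable {W : Type*} [Finite W] {H : SimpleGraph W}

open Classical in
/-- The product of the edge weights over the edges of a perfect matching. -/
def pmWeight (c : Sym2 W → ℝ) (P : PM H) : ℝ :=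
  ∏ e ∈ (Set.toFinite P.1.edgeSet).toFinset, c e

open Classical in
/-- The partition function of the perfect matching model. -/
def pmPartition (H : SimpleGraph W) (c : Sym2 W → ℝ) : ℝ :=
  letI : Fintype (PM H) := Fintype.ofFinite _
  ∑ P : PM H, pmWeight c P

end PMModel

namespace Embedding

variable {V E : Type*} {G : Multigraph V E} {R : Embedding G}

theorem IsTriangulation.face_eq [Finite V] [Finite E] (hT : R.IsTriangulation) (d : G.Dart) :
    R.facePerm (R.facePerm (R.facePerm d)) = d ∧ R.facePerm (R.facePerm d) ≠ d ∧
      ∀ d', R.face d' = R.face d ↔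
        d' = d ∨ d' = R.facePerm d ∨ d' = R.facePerm (R.facePerm d) := by
  classical
  have hc : ({d' | R.face d' = R.face d} : Set G.Dart).ncard = 3 := hT (R.face d)
  have h01 : R.facePerm d ≠ d := R.facePerm_ne d
  have h12 : R.facePerm (R.facePerm d) ≠ R.facePerm d := R.facePerm_ne _
  have h02 : R.facePerm (R.facePerm d) ≠ d := by
    intro h
    have hsub : ({d' | R.face d' = R.face d} : Set G.Dart) ⊆ {d, R.facePerm d} := by
      intro d' hd'
      obtain ⟨n, -, hn⟩ := (R.face_eq_iff.1 (Eq.symm hd')).exists_pow_eq'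
      rw [← hn]
      clear hn hd'
      induction n with
      | zero => simp
      | succ n ih =>
        rw [pow_succ', Equiv.Perm.mul_apply]
        rcases ih with ih | ih
        · rw [ih]; simp
        · rw [Set.mem_singleton_iff.1 ih, h]; simp
    have := Set.ncard_le_ncard hsub
    have h2 := Set.ncard_pair h01.symm
    omega
  have heq : ({d, R.facePerm d, R.facePerm (R.facePerm d)} : Set G.Dart)
      = {d' | R.face d' = R.face d} := by
    apply Set.eq_of_subset_of_ncard_le
    · rintro d' (rfl | rfl | rfl)
      · rfl
      · exact R.face_facePerm _
      · exact (R.face_facePerm _).trans (R.face_facePerm _)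
    · rw [hc, Set.ncard_eq_three.2 ⟨_, _, _, h01.symm, h02.symm, h12.symm, rfl⟩]
    · exact Set.toFinite _
  have hmem : ∀ d', R.face d' = R.face d ↔
      d' = d ∨ d' = R.facePerm d ∨ d' = R.facePerm (R.facePerm d) := by
    intro d'
    have := Set.ext_iff.1 heq d'
    simpa using this.symm
  refine ⟨?_, h02, hmem⟩
  have h3 := (hmem (R.facePerm (R.facePerm (R.facePerm d)))).1
    (by rw [R.face_facePerm, R.face_facePerm, R.face_facePerm])
  rcases h3 with h | h | h
  · exact h
  · exact absurd (R.facePerm.injective h) h02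
  · exact absurd h (R.facePerm_ne _)

theorem IsTriangulation.flip_face_ne [Finite V] [Finite E] (hT : R.IsTriangulation) (d : G.Dart) :
    R.face d.flip ≠ R.face d := by
  intro h
  obtain ⟨h3, -, hm⟩ := hT.face_eq d
  rcases (hm _).1 h with h | h | h
  · exact d.flip_ne h
  · have h2 := R.tail_facePerm (R.facePerm (R.facePerm d))
    rw [h3] at h2
    have h4 : (R.facePerm (R.facePerm d)).tail = d.tail := by
      rw [R.tail_facePerm, ← h, d.head_flip]
    exact (R.facePerm (R.facePerm d)).head_ne_tail (h2.symm.trans h4.symm)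
  · have h1 := R.tail_facePerm (R.facePerm d)
    have h2 := R.tail_facePerm d
    rw [← h] at h1
    exact (R.facePerm d).head_ne_tail (h1.symm.trans h2.symm)

/-- Every spin assignment agrees along an odd number of the three edges of a face, so the agreeing
intercity edges extend in exactly one way by city edges to a perfect matching. -/
theorem IsTriangulation.existsUnique_completion [Finite V] [Finite E] (hT : R.IsTriangulation)
    (X : V → ℤˣ) :
    ∃! P : PM R.expandedDual, P.1.edgeSet ∩ G.intercityEdges = G.agreeingEdges X := by
  classical
  have hagree : ∀ d : G.Dart, s(d, d.flip) ∈ G.agreeingEdges X ↔ X d.tail = X d.head := by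
    intro d
    constructor
    · rintro ⟨d', he, hX⟩
      rcases Sym2.eq_iff.1 he with ⟨rfl, -⟩ | ⟨rfl, -⟩
      · exact hX
      · rw [Dart.head_flip]; exact hX.symm
    · intro h; exact ⟨d, rfl, h⟩
  have hflip : ∀ d : G.Dart, X d.flip.tail = X d.flip.head ↔ X d.tail = X d.head := by
    intro d
    rw [d.head_flip]
    exact eq_comm
  let P0 : R.expandedDual.Subgraph :=
    { verts := Set.univ
      Adj := fun d d' => (d' = d.flip ∧ X d.tail = X d.head) ∨
        (d ≠ d' ∧ R.face d = R.face d' ∧ X d.tail ≠ X d.head ∧ X d'.tail ≠ X d'.head)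
      adj_sub := by
        rintro d d' (⟨h, -⟩ | ⟨h, h', -⟩)
        · exact Or.inl h
        · exact Or.inr ⟨h, h'⟩
      edge_vert := fun _ => Set.mem_univ _
      symm := ⟨by
        rintro d d' (⟨rfl, h⟩ | ⟨h, h', h1, h2⟩)
        · exact Or.inl ⟨d.flip_flip.symm, (hflip d).2 h⟩
        · exact Or.inr ⟨h.symm, h'.symm, h2, h1⟩⟩ }
  have hP0 : P0.IsPerfectMatching := by
    rw [SimpleGraph.Subgraph.isPerfectMatching_iff]
    intro d
    by_cases hd : X d.tail = X d.head
    · refine ⟨d.flip, Or.inl ⟨rfl, hd⟩, ?_⟩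
      rintro d' (⟨h, -⟩ | ⟨-, -, h, -⟩)
      · exact h
      · exact absurd hd h
    · obtain ⟨h3, h02, hm⟩ := hT.face_eq d
      have h01 := R.facePerm_ne d
      have t1 := R.tail_facePerm d
      have t2 := R.tail_facePerm (R.facePerm d)
      have t3 := R.tail_facePerm (R.facePerm (R.facePerm d))
      rw [h3] at t3
      have f1 := R.face_facePerm d
      have f2 := (R.face_facePerm (R.facePerm d)).trans f1
      have hcase : ∀ a b c : ℤˣ, a ≠ b → (b = c ↔ c ≠ a) := by decide
      have key := hcase (X d.tail) (X d.head) (X (R.facePerm d).head) hd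
      by_cases h : X d.head = X (R.facePerm d).head
      · refine ⟨R.facePerm (R.facePerm d), Or.inr ⟨h02.symm, f2.symm, hd, ?_⟩, ?_⟩
        · rw [t2, ← t3]; exact key.1 h
        · rintro d' (⟨-, h'⟩ | ⟨hne, hf, -, hX⟩)
          · exact absurd h' hd
          · rcases (hm d').1 hf.symm with rfl | rfl | rfl
            · exact absurd rfl hne
            · rw [t1] at hX; exact absurd h hX
            · rfl
      · refine ⟨R.facePerm d, Or.inr ⟨h01.symm, f1.symm, hd, ?_⟩, ?_⟩
        · rw [t1]; exact h
        · rintro d' (⟨-, h'⟩ | ⟨hne, hf, -, hX⟩)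
          · exact absurd h' hd
          · rcases (hm d').1 hf.symm with rfl | rfl | rfl
            · exact absurd rfl hne
            · rfl
            · rw [t2, ← t3] at hX; exact absurd (key.2 hX) h
  refine ⟨⟨P0, hP0⟩, ?_, ?_⟩
  · ext e
    constructor
    · rintro ⟨he, d, rfl⟩
      rw [SimpleGraph.Subgraph.mem_edgeSet] at he
      rcases he with ⟨-, h⟩ | ⟨-, h, -⟩
      · exact ⟨d, rfl, h⟩
      · exact absurd h.symm (hT.flip_face_ne d)
    · rintro ⟨d, rfl, h⟩
      exact ⟨SimpleGraph.Subgraph.mem_edgeSet.2 (Or.inl ⟨rfl, h⟩), d, rfl⟩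
  · rintro ⟨P, hP⟩ hI
    have hI' : P.edgeSet ∩ G.intercityEdges = G.agreeingEdges X := hI
    have hIadj : ∀ d : G.Dart, P.Adj d d.flip ↔ X d.tail = X d.head := by
      intro d
      rw [← hagree d, ← hI', ← SimpleGraph.Subgraph.mem_edgeSet]
      exact ⟨fun h => ⟨h, d, rfl⟩, fun h => h.1⟩
    have hu := SimpleGraph.Subgraph.isPerfectMatching_iff.1 hP
    have hu0 := SimpleGraph.Subgraph.isPerfectMatching_iff.1 hP0
    have hunsat : ∀ d d', P.Adj d d' → d' ≠ d.flip → X d.tail ≠ X d.head := by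
      intro d d' h hne hX
      exact hne ((hu d).unique h ((hIadj d).2 hX))
    have hle : ∀ d d', P.Adj d d' → P0.Adj d d' := by
      intro d d' h
      by_cases hf : d' = d.flip
      · subst hf
        exact Or.inl ⟨rfl, (hIadj d).1 h⟩
      · have hf' : d ≠ d'.flip := fun h' => hf (by rw [h', d'.flip_flip])
        rcases P.adj_sub h with h' | ⟨h1, h2⟩
        · exact absurd h' hf
        · exact Or.inr ⟨h1, h2, hunsat d d' h hf, hunsat d' d h.symm hf'⟩
    apply Subtype.ext
    apply SimpleGraph.Subgraph.ext
    · exact (SimpleGraph.Subgraph.isSpanning_iff.1 hP.2).trans rfl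
    · funext d d'
      apply propext
      refine ⟨hle d d', fun h => ?_⟩
      obtain ⟨w, hw, -⟩ := hu d
      rwa [(hu0 d).unique h (hle d w hw)]

/-- The map `M`: the unique perfect matching of the expanded dual graph whose intercity edges are
exactly those crossing an edge of `G` whose end vertices have equal spins. -/
def IsTriangulation.toPM [Finite V] [Finite E] (hT : R.IsTriangulation) (X : V → ℤˣ) :
    PM R.expandedDual :=
  (hT.existsUnique_completion X).choose

end Embedding

end PlanarIsing

end

namespace PlanarIsing

open Multigraph

/-! The map `toPM` is onto and two-to-one, and it preserves weights up to a constant factor. Adding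
`∑ J e` to the energy turns each term `J e * x_v * x_w` into `2 * J e` or `0`, according to whether
the spins agree; so the matching of `X` has weight `exp (energy + ∑ J e)` (`pmWeight_toPM`). As the
graph is connected, its agreeing edges determine `X` up to a global sign (`toPM_eq_toPM_iff`), so
the fibres are the pairs `{X, -X}`.

Surjectivity (`toPM_surjective`) is the topological part. The intercity edges missing from a
matching cross evenly many sides of each face, so they define a cocycle modulo 2. On the sphere it
is the coboundary of a spin assignment (`exists_coboundary`): Euler's formula makes the ranks of the
two incidence matrices match. Summing over fibres gives the partition function, and the law is a sum
of two equal probabilities. -/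

/-- A space of constant functions has dimension at most one. -/
theorem finrank_le_one_of_forall_constant {K α : Type*} [Field K] [Finite α]
    (W : Submodule K (α → K)) (hW : ∀ x ∈ W, ∀ a b, x a = x b) : Module.finrank K W ≤ 1 := by
  rcases isEmpty_or_nonempty α with hα | ⟨⟨a⟩⟩
  · exact (Module.finrank_zero_of_subsingleton).le.trans zero_le_one
  · have hinj : Function.Injective ((LinearMap.proj a : (α → K) →ₗ[K] K).comp W.subtype) := by
      intro x y h
      apply Subtype.ext
      funext b
      have h' : x.1 a = y.1 a := h
      rw [hW x.1 x.2 b a, hW y.1 y.2 b a, h']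
    exact (LinearMap.finrank_le_finrank_of_injective hinj).trans (Module.finrank_self K).le

/-! ### Connectivity and the two darts of an edge -/

namespace Multigraph

variable {V E : Type*} {G : Multigraph V E}

theorem Connected.eq_of_forall_dart {α : Type*} (hG : G.Connected) {x : V → α}
    (hx : ∀ d : G.Dart, x d.tail = x d.head) (u v : V) : x u = x v := by
  obtain ⟨p⟩ := hG.preconnected u v
  induction p with
  | nil => rfl
  | @cons u v w h p ih =>
    refine Eq.trans ?_ ih
    have key : ∀ a b, (∃ e, G.ends e = s(a, b)) → x a = x b := by
      rintro a b ⟨e, he⟩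
      let d : G.Dart := ⟨(e, a), by rw [he]; exact Sym2.mem_mk_left a b⟩
      have h1 := d.ends_edge
      have h2 : G.ends d.edge = s(a, b) := he
      rw [h2] at h1
      have hb : b = d.head := Sym2.congr_right.1 h1
      rw [hb]
      exact hx d
    rcases (SimpleGraph.fromRel_adj _ _ _).1 h with ⟨-, h | h⟩
    · exact key _ _ h
    · exact (key _ _ h).symm

theorem Dart.eq_or_eq_flip {d d' : G.Dart} (h : d'.edge = d.edge) : d' = d ∨ d' = d.flip := by
  have h1 := d.ends_edge
  have h2 := d'.ends_edge
  rw [h, h1] at h2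
  rcases Sym2.eq_iff.1 h2 with ⟨h3, -⟩ | ⟨-, h3⟩
  · exact Or.inl (Dart.ext_edge_tail h h3.symm)
  · exact Or.inr (Dart.ext_edge_tail h h3.symm)

theorem exists_dart (G : Multigraph V E) (e : E) : ∃ d : G.Dart, d.edge = e :=
  ⟨⟨(e, (G.ends e).out.1), Sym2.out_fst_mem _⟩, rfl⟩

/-- An orientation of every edge. -/
noncomputable def someDart (G : Multigraph V E) (e : E) : G.Dart := (G.exists_dart e).choose

theorem edge_someDart (e : E) : (G.someDart e).edge = e := (G.exists_dart e).choose_spec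

theorem sum_darts_of_edge [Fintype G.Dart] [DecidableEq E] {M : Type*} [AddCommMonoid M]
    (d : G.Dart) (f : G.Dart → M) :
    (∑ d' : G.Dart, if d'.edge = d.edge then f d' else 0) = f d + f d.flip := by
  classical
  rw [← Finset.sum_filter]
  have : (Finset.univ.filter fun d' : G.Dart => d'.edge = d.edge) = {d, d.flip} := by
    ext d'
    simp only [Finset.mem_filter, Finset.mem_univ, true_and, Finset.mem_insert,
      Finset.mem_singleton]
    refine ⟨Dart.eq_or_eq_flip, ?_⟩
    rintro (rfl | rfl) <;> rfl
  rw [this, Finset.sum_pair d.flip_ne.symm]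

end Multigraph

/-! ### Cocycles and coboundaries modulo 2 on a plane graph -/

namespace Embedding

variable {V E : Type*} {G : Multigraph V E} (R : Embedding G)

/-- The dual graph of a connected graph is connected. -/
theorem eq_of_forall_flip {α : Type*} (hG : G.Connected) {φ : R.Face → α}
    (hφ : ∀ d : G.Dart, φ (R.face d) = φ (R.face d.flip)) (f f' : R.Face) : φ f = φ f' := by
  have hnext : ∀ d, φ (R.face (R.next d)) = φ (R.face d) := by
    intro d
    have h := R.facePerm_apply d.flip
    rw [d.flip_flip] at h
    rw [← h, R.face_facePerm, hφ d]
  have htail : ∀ d d' : G.Dart, d.tail = d'.tail → φ (R.face d) = φ (R.face d') := by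
    intro d d' h
    obtain ⟨n, rfl⟩ := R.next_cyclic d d' h
    have hpow : ∀ k : ℕ, ∀ d, φ (R.face ((R.next ^ k) d)) = φ (R.face d) := by
      intro k
      induction k with
      | zero => intro d; rfl
      | succ k ih => intro d; rw [pow_succ', Equiv.Perm.mul_apply, hnext, ih]
    rcases n with k | k
    · exact (hpow k d).symm
    · rw [zpow_negSucc]
      simpa using hpow (k + 1) ((R.next ^ (k + 1))⁻¹ d)
  induction f using Quotient.inductionOn with | _ d =>
  induction f' using Quotient.inductionOn with | _ d' =>
  change φ (R.face d) = φ (R.face d')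
  -- The set of values of `φ` on the faces around `v` has at most one element. Taking sets avoids
  -- choosing a dart at `v`; both ends of an edge see the face of `d`, so connectedness applies.
  let s : V → Set α := fun v => {a | ∃ d : G.Dart, d.tail = v ∧ φ (R.face d) = a}
  have hs := hG.eq_of_forall_dart (x := s) (by
    intro d
    ext a
    constructor
    · rintro ⟨d1, h1, rfl⟩
      exact ⟨d.flip, rfl, by rw [← hφ d, htail d1 d h1]⟩
    · rintro ⟨d1, h1, rfl⟩
      exact ⟨d, rfl, by rw [hφ d, htail d1 d.flip h1]⟩) d.tail d'.tail
  have hm : φ (R.face d) ∈ s d'.tail := hs ▸ ⟨d, rfl, rfl⟩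
  obtain ⟨d1, h1, h2⟩ := hm
  rw [← h2, htail d1 d' h1]

open Classical in
/-- On a plane graph, a `ZMod 2`-valued function on the edges which sums to zero around every face
is a coboundary. -/
theorem IsPlanar.exists_coboundary [Fintype V] [Fintype E] {R : Embedding G} (hP : R.IsPlanar)
    (c : E → ZMod 2)
    (hc : ∀ f : R.Face, (∑ d : G.Dart, if R.face d = f then c d.edge else 0) = 0) :
    ∃ x : V → ZMod 2, ∀ d : G.Dart, x d.tail + x d.head = c d.edge := by
  let _ : Fintype R.Face := Fintype.ofFinite _
  obtain ⟨hG, hE⟩ := hP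
  -- Incidences are counted by darts, so an edge with the same face on both sides contributes `1 + 1
  -- = 0`.
  let A : Matrix R.Face E (ZMod 2) := Matrix.of fun f e =>
    ∑ d : G.Dart, if R.face d = f ∧ d.edge = e then 1 else 0
  let B : Matrix E V (ZMod 2) := Matrix.of fun e v =>
    ∑ d : G.Dart, if d.edge = e then (if d.tail = v then 1 else 0) else 0
  have hA : ∀ c f, (A.mulVec c) f = ∑ d : G.Dart, if R.face d = f then c d.edge else 0 := by
    intro c f
    simp only [A, Matrix.mulVec, dotProduct, Finset.sum_mul, Matrix.of_apply]
    rw [Finset.sum_comm]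
    refine Finset.sum_congr rfl fun d _ => ?_
    by_cases h : R.face d = f <;> simp [h]
  have hAt : ∀ φ (d : G.Dart),
      (A.transpose.mulVec φ) d.edge = φ (R.face d) + φ (R.face d.flip) := by
    intro φ d
    rw [← sum_darts_of_edge d fun d => φ (R.face d)]
    simp only [A, Matrix.mulVec, dotProduct, Finset.sum_mul, Matrix.transpose_apply, Matrix.of_apply]
    rw [Finset.sum_comm]
    refine Finset.sum_congr rfl fun d' _ => ?_
    by_cases h : d'.edge = d.edge <;> simp [h]
  have hB : ∀ x (d : G.Dart), (B.mulVec x) d.edge = x d.tail + x d.head := by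
    intro x d
    have h := sum_darts_of_edge d fun d => x d.tail
    change _ = x d.tail + x d.head at h
    rw [← h]
    simp only [B, Matrix.mulVec, dotProduct, Finset.sum_mul, Matrix.of_apply]
    rw [Finset.sum_comm]
    refine Finset.sum_congr rfl fun d' _ => ?_
    by_cases h : d'.edge = d.edge <;> simp [h]
  -- The kernel of the transpose consists of functions constant across every edge, hence constant
  -- because the dual graph is connected.
  have hkA : Module.finrank (ZMod 2) (LinearMap.ker A.transpose.mulVecLin) ≤ 1 := by
    refine finrank_le_one_of_forall_constant _ fun φ hφ => R.eq_of_forall_flip hG fun d => ?_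
    have h := congrFun (LinearMap.mem_ker.1 hφ) d.edge
    rw [Matrix.mulVecLin_apply, hAt, Pi.zero_apply] at h
    exact CharTwo.add_eq_zero.1 h
  have hkB : Module.finrank (ZMod 2) (LinearMap.ker B.mulVecLin) ≤ 1 := by
    refine finrank_le_one_of_forall_constant _ fun x hx => hG.eq_of_forall_dart fun d => ?_
    have h := congrFun (LinearMap.mem_ker.1 hx) d.edge
    rw [Matrix.mulVecLin_apply, hB, Pi.zero_apply] at h
    exact CharTwo.add_eq_zero.1 h
  have hle : LinearMap.range B.mulVecLin ≤ LinearMap.ker A.mulVecLin := by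
    rintro _ ⟨x, rfl⟩
    rw [LinearMap.mem_ker]
    funext f
    rw [Matrix.mulVecLin_apply, Matrix.mulVecLin_apply, hA, Pi.zero_apply]
    simp only [hB]
    have h1 : ∀ d : G.Dart, x d.head = x (R.facePerm d).tail := fun d => by rw [R.tail_facePerm]
    -- A face boundary is a closed walk: shifting by `facePerm` turns heads into tails, so each
    -- vertex value is counted twice.
    have h2 : (∑ d : G.Dart, if R.face d = f then x d.head else 0)
        = ∑ d : G.Dart, if R.face d = f then x d.tail else 0 := by
      rw [← Equiv.sum_comp R.facePerm fun d => if R.face d = f then x d.tail else 0]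
      refine Finset.sum_congr rfl fun d _ => ?_
      rw [R.face_facePerm, h1]
    have h3 : ∀ d : G.Dart, (if R.face d = f then x d.tail + x d.head else 0)
        = (if R.face d = f then x d.tail else 0) + (if R.face d = f then x d.head else 0) := by
      intro d
      split_ifs <;> simp
    rw [Finset.sum_congr rfl fun d _ => h3 d, Finset.sum_add_distrib, h2, CharTwo.add_self_eq_zero]
  -- Since row and column ranks agree, `dim ker A ≤ |E| - |F| + 1`. By Euler's formula this is `|V|
  -- - 1`, which is at most `rank B`.
  have hrk : LinearMap.range B.mulVecLin = LinearMap.ker A.mulVecLin := by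
    apply Submodule.eq_of_le_of_finrank_le hle
    have e1 := LinearMap.finrank_range_add_finrank_ker B.mulVecLin
    have e2 := LinearMap.finrank_range_add_finrank_ker A.mulVecLin
    have e3 := LinearMap.finrank_range_add_finrank_ker A.transpose.mulVecLin
    have e4 := A.rank_transpose
    unfold Matrix.rank at e4
    simp only [Module.finrank_pi, Nat.card_eq_fintype_card] at e1 e2 e3 hE
    omega
  have hcA : c ∈ LinearMap.ker A.mulVecLin := by
    rw [LinearMap.mem_ker]
    funext f
    rw [Matrix.mulVecLin_apply, hA, hc, Pi.zero_apply]
  rw [← hrk] at hcA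
  obtain ⟨x, hx⟩ := hcA
  exact ⟨x, fun d => by rw [← hB, ← hx, Matrix.mulVecLin_apply]⟩

end Embedding

/-! ### Weights, energies and the sign ambiguity -/

namespace Multigraph

variable {V E : Type*} {G : Multigraph V E}

theorem mem_agreeingEdges {X : V → ℤˣ} {d : G.Dart} :
    s(d, d.flip) ∈ G.agreeingEdges X ↔ X d.tail = X d.head := by
  constructor
  · rintro ⟨d', he, hX⟩
    rcases Sym2.eq_iff.1 he with ⟨rfl, -⟩ | ⟨rfl, -⟩
    · exact hX
    · rw [Dart.head_flip]; exact hX.symm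
  · exact fun h => ⟨d, rfl, h⟩

theorem dualWeight_intercity (J : E → ℝ) (d : G.Dart) :
    G.dualWeight J s(d, d.flip) = Real.exp (2 * J d.edge) := by
  simp [dualWeight]

theorem dualWeight_of_notMem (J : E → ℝ) {e : Sym2 G.Dart} (he : e ∉ G.intercityEdges) :
    G.dualWeight J e = 1 := by
  induction e using Sym2.ind with | _ d d' =>
  have h : d' ≠ d.flip := fun h => he ⟨d, by rw [h]⟩
  simp [dualWeight, h]

theorem energy_eq_sum [Fintype E] (J : E → ℝ) (X : V → ℤˣ) :
    G.energy J X
      = ∑ e, J e * (((X (G.someDart e).tail : ℤ) : ℝ) * ((X (G.someDart e).head : ℤ) : ℝ)) := by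
  refine Finset.sum_congr rfl fun e => fun _ => ?_
  have h := (G.someDart e).ends_edge
  rw [edge_someDart] at h
  rw [h]
  simp

open Classical in
theorem exp_energy_mul_exp_sum [Fintype E] (J : E → ℝ) (X : V → ℤˣ) :
    Real.exp (G.energy J X) * Real.exp (∑ e, J e)
      = ∏ e, if X (G.someDart e).tail = X (G.someDart e).head then Real.exp (2 * J e) else 1 := by
  rw [← Real.exp_add, energy_eq_sum, ← Finset.sum_add_distrib, Real.exp_sum]
  refine Finset.prod_congr rfl fun e _ => ?_
  rcases Int.units_eq_one_or (X (G.someDart e).tail) with h | h <;>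
    rcases Int.units_eq_one_or (X (G.someDart e).head) with h' | h' <;>
    simp [h, h', two_mul]

theorem Connected.agreeing_iff (hG : G.Connected) {X Y : V → ℤˣ} :
    (∀ d : G.Dart, (Y d.tail = Y d.head ↔ X d.tail = X d.head)) ↔ Y = X ∨ Y = -X := by
  constructor
  · intro h
    have key : ∀ a b c d : ℤˣ, (a = b ↔ c = d) → a * c = b * d := by decide
    -- Equal agreement patterns mean that `Y` and `X` change sign across the same edges, so their
    -- product is constant.
    have hc := hG.eq_of_forall_dart (x := fun v => Y v * X v) fun d => key _ _ _ _ (h d)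
    obtain ⟨v⟩ := hG.nonempty
    have hmul : ∀ a b : ℤˣ, (a * b = 1 → a = b) ∧ (a * b = -1 → a = -b) := by decide
    rcases Int.units_eq_one_or (Y v * X v) with h1 | h1
    · exact Or.inl (funext fun w => (hmul _ _).1 ((hc w v).trans h1))
    · exact Or.inr (funext fun w => (hmul _ _).2 ((hc w v).trans h1))
  · rintro (rfl | rfl) d
    · rfl
    · simp

end Multigraph

/-! ### The map from spins to perfect matchings -/

namespace Embedding

variable {V E : Type*} {G : Multigraph V E} {R : Embedding G}

-- City edges have weight 1, so only intercity edges count, and these are indexed by the edges of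
-- `G`.
open Classical in
theorem pmWeight_dualWeight [Finite V] [Fintype E] (J : E → ℝ) (P : PM R.expandedDual) :
    pmWeight (G.dualWeight J) P
      = ∏ e, if P.1.Adj (G.someDart e) (G.someDart e).flip then Real.exp (2 * J e) else 1 := by
  have hinj : Function.Injective fun e => s(G.someDart e, (G.someDart e).flip) := by
    intro e e' h
    rcases Sym2.eq_iff.1 h with ⟨h1, -⟩ | ⟨h1, -⟩
    · rw [← edge_someDart (G := G) e, h1, edge_someDart]
    · rw [← edge_someDart (G := G) e, h1, Dart.edge_flip, edge_someDart]
  rw [← Finset.prod_filter, pmWeight]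
  symm
  calc _ = ∏ e ∈ (Finset.univ.filter fun e => P.1.Adj (G.someDart e) (G.someDart e).flip).image
        fun e => s(G.someDart e, (G.someDart e).flip), G.dualWeight J e := by
        rw [Finset.prod_image hinj.injOn]
        refine Finset.prod_congr rfl fun e _ => ?_
        rw [dualWeight_intercity, edge_someDart]
    _ = _ := by
      apply Finset.prod_subset
      · intro a ha
        obtain ⟨e, he, rfl⟩ := Finset.mem_image.1 ha
        simpa using he
      · intro a ha hna
        apply dualWeight_of_notMem
        rintro ⟨d, rfl⟩
        apply hna
        have had : P.1.Adj d d.flip := by simpa using ha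
        refine Finset.mem_image.2 ⟨d.edge, ?_⟩
        rcases Dart.eq_or_eq_flip (edge_someDart (G := G) d.edge) with h | h
        · simpa [h] using had
        · simpa [h, d.flip_flip, Sym2.eq_swap] using had.symm

theorem IsTriangulation.toPM_eq_iff [Finite V] [Finite E] (hT : R.IsTriangulation)
    {X : V → ℤˣ} {P : PM R.expandedDual} :
    hT.toPM X = P ↔ ∀ d : G.Dart, P.1.Adj d d.flip ↔ X d.tail = X d.head := by
  have hspec := (hT.existsUnique_completion X).choose_spec
  have h1 : hT.toPM X = P ↔ P.1.edgeSet ∩ G.intercityEdges = G.agreeingEdges X :=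
    ⟨fun h => h ▸ hspec.1, fun h => (hspec.2 P h).symm⟩
  rw [h1]
  constructor
  · intro h d
    rw [← mem_agreeingEdges, ← h]
    exact ⟨fun h => ⟨h, d, rfl⟩, fun h => h.1⟩
  · intro h
    ext e
    constructor
    · rintro ⟨he, d, rfl⟩
      exact mem_agreeingEdges.2 ((h d).1 he)
    · rintro ⟨d, rfl, hX⟩
      exact ⟨(h d).2 hX, d, rfl⟩

theorem IsTriangulation.pmWeight_toPM [Finite V] [Fintype E] (hT : R.IsTriangulation)
    (J : E → ℝ) (X : V → ℤˣ) :
    pmWeight (G.dualWeight J) (hT.toPM X)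
      = Real.exp (G.energy J X) * Real.exp (∑ e, J e) := by
  classical
  rw [pmWeight_dualWeight, exp_energy_mul_exp_sum]
  simp only [hT.toPM_eq_iff.1 rfl]

theorem IsTriangulation.toPM_eq_toPM_iff [Finite V] [Finite E] (hT : R.IsTriangulation)
    (hG : G.Connected) {X Y : V → ℤˣ} : hT.toPM Y = hT.toPM X ↔ Y = X ∨ Y = -X := by
  rw [hT.toPM_eq_iff, ← hG.agreeing_iff]
  refine forall_congr' fun d => ?_
  rw [hT.toPM_eq_iff.1 rfl d]
  exact iff_comm

open Classical in
/-- The intercity edges missing from a perfect matching cross an even number of the edges of every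
face. -/
theorem IsTriangulation.sum_missing_eq_zero [Fintype V] [Fintype E] (hT : R.IsTriangulation)
    (P : PM R.expandedDual) (f : R.Face) :
    (∑ d : G.Dart, if R.face d = f then (if P.1.Adj d d.flip then (0 : ZMod 2) else 1) else 0)
      = 0 := by
  have hu := SimpleGraph.Subgraph.isPerfectMatching_iff.1 P.2
  have hnf := hT.flip_face_ne
  induction f using Quotient.inductionOn with | _ a =>
  change (∑ d : G.Dart, if R.face d = R.face a then _ else 0) = 0
  obtain ⟨h3, h02, hm⟩ := hT.face_eq a
  set b := R.facePerm a with hb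
  set c := R.facePerm b with hc
  have h01 : a ≠ b := (R.facePerm_ne a).symm
  have h12 : b ≠ c := (R.facePerm_ne b).symm
  have hfilter : (Finset.univ.filter fun d : G.Dart => R.face d = R.face a) = {a, b, c} := by
    ext d
    simp [hm]
  rw [← Finset.sum_filter, hfilter, Finset.sum_insert (by simp [h01, h02.symm]),
    Finset.sum_pair h12]
  have fb : R.face b = R.face a := (hm b).2 (by simp)
  have fc : R.face c = R.face a := (hm c).2 (by simp)
  have hcase : ∀ d, R.face d = R.face a →
      ∃ d', P.1.Adj d d' ∧ (P.1.Adj d d.flip → d' = d.flip) ∧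
        (¬ P.1.Adj d d.flip → d' ≠ d ∧ (d' = a ∨ d' = b ∨ d' = c)) := by
    intro d hd
    obtain ⟨d', h, -⟩ := hu d
    refine ⟨d', h, fun h' => (hu d).unique h h', fun h' => ?_⟩
    rcases P.1.adj_sub h with rfl | ⟨hne, hf⟩
    · exact absurd h h'
    · exact ⟨hne.symm, (hm d').1 (hf.symm.trans hd)⟩
  have huniq : ∀ {x y z}, P.1.Adj x y → P.1.Adj x z → y = z := fun h h' => (hu _).unique h h'
  have hne : ∀ x y, R.face x = R.face a → R.face y = R.face a → y ≠ x.flip := by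
    rintro x y hx hy rfl
    exact hnf x (hy.trans hx.symm)
  obtain ⟨a', ha, ha1, ha2⟩ := hcase a rfl
  obtain ⟨b', hb', hb1, hb2⟩ := hcase b fb
  obtain ⟨c', hc', hc1, hc2⟩ := hcase c fc
  have e11 : (1 : ZMod 2) + 1 = 0 := by decide
  clear_value b c
  -- Corners not matched across their intercity edge are matched to each other inside the city,
  -- hence in pairs: one or three missing edges is impossible, and two cancel modulo 2. By `hne` no
  -- intercity edge joins two corners of this city.
  by_cases pa : P.1.Adj a a.flip <;> by_cases pb : P.1.Adj b b.flip <;>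
    by_cases pc : P.1.Adj c c.flip <;> simp only [pa, pb, pc, if_true, if_false] <;>
    grind [SimpleGraph.Subgraph.Adj.symm]

theorem IsTriangulation.toPM_surjective [Fintype V] [Fintype E] (hT : R.IsTriangulation)
    (hP : R.IsPlanar) : Function.Surjective hT.toPM := by
  classical
  intro P
  let m : G.Dart → ZMod 2 := fun d => if P.1.Adj d d.flip then 0 else 1
  have hmflip : ∀ d, m d.flip = m d := by
    intro d
    simp only [m, d.flip_flip, P.1.adj_comm d.flip d]
  have hm : ∀ d : G.Dart, m (G.someDart d.edge) = m d := by
    intro d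
    rcases Dart.eq_or_eq_flip (edge_someDart (G := G) d.edge) with h | h
    · rw [h]
    · rw [h, hmflip]
  obtain ⟨x, hx⟩ := hP.exists_coboundary (fun e => m (G.someDart e)) fun f => by
    simp only [hm]
    exact hT.sum_missing_eq_zero P f
  -- Reading the potential `x` as a spin makes disagreement across an edge the same as its
  -- coboundary being 1, that is, as the edge being missing.
  refine ⟨fun v => if x v = 0 then 1 else -1, hT.toPM_eq_iff.2 fun d => ?_⟩
  have h := hx d
  simp only [hm] at h
  have hadj : P.1.Adj d d.flip ↔ m d = 0 := by simp [m]
  rw [hadj, ← h]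
  have key : ∀ s t : ZMod 2,
      s + t = 0 ↔ (if s = 0 then (1 : ℤˣ) else -1) = (if t = 0 then 1 else -1) := by decide
  exact key _ _

end Embedding

end PlanarIsing

/-! ### The law of the matching and its partition function -/

open PlanarIsing Multigraph

theorem mainTheorem6 {V E : Type*} [Fintype V] [Fintype E]
    (G : PlanarIsing.Multigraph V E) (R : PlanarIsing.Embedding G)
    (hP : R.IsPlanar) (hT : R.IsTriangulation) (J : E → ℝ)
    {Ω : Type*} [MeasurableSpace Ω] (μ : MeasureTheory.Measure Ω)
    [MeasureTheory.IsProbabilityMeasure μ]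
    (S : Ω → V → ℤˣ) (hS : Measurable S)
    (hlaw : ∀ X : V → ℤˣ,
      μ.real {ω | S ω = X} = 1 / G.isingPartition J * Real.exp (G.energy J X)) :
    (∀ E' : PlanarIsing.PM R.expandedDual,
      μ.real {ω | hT.toPM (S ω) = E'} =
        1 / PlanarIsing.pmPartition R.expandedDual (G.dualWeight J) *
          PlanarIsing.pmWeight (G.dualWeight J) E') ∧
    PlanarIsing.pmPartition R.expandedDual (G.dualWeight J) =
      1 / 2 * G.isingPartition J * Real.exp (∑ e, J e) := by
  classical
  have hG := hP.1
  obtain ⟨v⟩ := hG.nonempty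
  have hne : ∀ X : V → ℤˣ, X ≠ -X := fun X h => by
    have key : ∀ a : ℤˣ, a ≠ -a := by decide
    exact key (X v) (congrFun h v)
  have hZ : 0 < G.isingPartition J :=
    Finset.sum_pos (fun _ _ => Real.exp_pos _) Finset.univ_nonempty
  have hpart : pmPartition R.expandedDual (G.dualWeight J) =
      1 / 2 * G.isingPartition J * Real.exp (∑ e, J e) := by
    have h1 : G.isingPartition J * Real.exp (∑ e, J e)
        = ∑ X : V → ℤˣ, pmWeight (G.dualWeight J) (hT.toPM X) := by
      rw [isingPartition, Finset.sum_mul]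
      exact Finset.sum_congr rfl fun X _ => (hT.pmWeight_toPM J X).symm
    let _ : Fintype (PM R.expandedDual) := Fintype.ofFinite _
    have h2 : ∑ X : V → ℤˣ, pmWeight (G.dualWeight J) (hT.toPM X)
        = ∑ P : PM R.expandedDual, 2 * pmWeight (G.dualWeight J) P := by
      rw [← Finset.sum_fiberwise (g := hT.toPM)]
      refine Finset.sum_congr rfl fun P _ => ?_
      obtain ⟨X, rfl⟩ := hT.toPM_surjective hP P
      have hfib : (Finset.univ.filter fun Y => hT.toPM Y = hT.toPM X) = {X, -X} := by
        ext Y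
        simp [hT.toPM_eq_toPM_iff hG]
      rw [hfib, Finset.sum_pair (hne X), (hT.toPM_eq_toPM_iff hG).2 (Or.inr rfl), two_mul]
    rw [← Finset.mul_sum] at h2
    rw [mul_assoc, h1, h2, ← mul_assoc, pmPartition]
    norm_num
  refine ⟨fun P => ?_, hpart⟩
  obtain ⟨X, rfl⟩ := hT.toPM_surjective hP P
  have hmeas : MeasurableSet {ω | S ω = -X} := by
    have : {ω | S ω = -X} = ⋂ v, {ω | S ω v = -X v} := by
      ext ω
      simp [funext_iff]
    rw [this]
    refine MeasurableSet.iInter fun v => ?_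
    -- The σ-algebra on `ℤˣ` is pulled back from `ℤ`, where singletons are measurable.
    have hsing : MeasurableSet ({-X v} : Set ℤˣ) := by
      have : ({-X v} : Set ℤˣ) = Units.val ⁻¹' {((-X v : ℤˣ) : ℤ)} := by
        ext a
        simp only [Set.mem_singleton_iff, Set.mem_preimage, Units.val_inj]
      rw [this]
      exact (comap_measurable Units.val) (measurableSet_singleton _)
    exact (measurable_pi_iff.1 hS v) hsing
  have hset : {ω | hT.toPM (S ω) = hT.toPM X} = {ω | S ω = X} ∪ {ω | S ω = -X} := by
    ext ω
    exact hT.toPM_eq_toPM_iff hG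
  have hdisj : Disjoint {ω | S ω = X} {ω | S ω = -X} :=
    Set.disjoint_left.2 fun ω h h' => hne X (h.symm.trans h')
  -- Spin-flip symmetry is read off the weights, since `X` and `-X` have the same matching.
  have hneg : Real.exp (G.energy J (-X)) = Real.exp (G.energy J X) := by
    have h := hT.pmWeight_toPM J (-X)
    rw [(hT.toPM_eq_toPM_iff hG).2 (Or.inr rfl), hT.pmWeight_toPM J X] at h
    exact (mul_right_cancel₀ (Real.exp_ne_zero _) h).symm
  rw [hset, MeasureTheory.measureReal_union hdisj hmeas, hlaw, hlaw, hneg, hpart,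
    hT.pmWeight_toPM J X]
  have := Real.exp_pos (∑ e, J e)
  field_simp
  ring
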